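/- Let $A$ be a (complex, not necessarily unital) C*-algebra, and let $A^1_+$ be the set of positive elements of $A$ of norm at most $1$. For $a,b\in A$ write $a\ll b$ if $a=ab$. A subset $U\subseteq A$ is called $\ll$-directed if for all $p,q\in U$ there is $r\in U$ with $p\ll r$ and $q\ll r$. A $\ll$-unit for $A$ is a $\ll$-directed set $U\subseteq A^1_+$ such that for every $a\in A$ and every $\varepsilon>0$ there is $u\in U$ with $\|a-au\|<\varepsilon$. Call $A$ $\sigma$-unital if it has a countable approximate unit, that is, a net $(u_\lambda)_{\lambda\in\Lambda}$ in $A^1_+$, indexed by a countable nonempty set $\Lambda$ directed by a transitive relation, such that $\|a-au_\lambda\|\to 0$ for every $a\in A$. **Corollary 4.3.** If $A$ is $\sigma$-unital, then for every countable $\ll$-directed set $B\subseteq A^1_+$ there is a countable $\ll$-unit $U$ for $A$ such that $B\subseteq U$. -/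

import Mathlib

namespace WayBelowUnits

/-- The positive part `A¹₊` of the closed unit ball of `A`: the positive contractions. -/
def PositiveUnitBall (A : Type*) [NonUnitalCStarAlgebra A] [PartialOrder A] : Set A :=
  {a : A | 0 ≤ a ∧ ‖a‖ ≤ 1}

/-- The relation `a ≪ b`, meaning `a = a b`. -/
def WayBelow {A : Type*} [NonUnitalCStarAlgebra A] (a b : A) : Prop :=
  a = a * b

/-- The relation `a ≪_ε b`, meaning `‖a - a b‖ < ε`. -/
def ApproxWayBelow {A : Type*} [NonUnitalCStarAlgebra A] (ε : ℝ) (a b : A) : Prop :=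
  ‖a - a * b‖ < ε

/-- `U` is `≪`-approximately cofinal in `B`. -/
def IsApproxCofinalIn {A : Type*} [NonUnitalCStarAlgebra A] (U B : Set A) : Prop :=
  ∀ b ∈ B, ∀ ε : ℝ, 0 < ε → ∃ u ∈ U, ApproxWayBelow ε b u

/-- `U` is `≪`-directed: any two (possibly equal) elements of `U` are `≪` some element of `U`. -/
def IsWayBelowDirected {A : Type*} [NonUnitalCStarAlgebra A] (U : Set A) : Prop :=
  DirectedOn WayBelow U

/-- `U` is a `≪`-unit for `A`. -/
structure IsWayBelowUnit {A : Type*} [NonUnitalCStarAlgebra A] [PartialOrder A]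
    (U : Set A) : Prop where
  subset_ball : U ⊆ PositiveUnitBall A
  approxCofinal : IsApproxCofinalIn U Set.univ
  directed : IsWayBelowDirected U

/-- The net `u`, indexed by a nonempty set `Λ` directed by a transitive relation `r` (which need
not be reflexive), is an approximate unit: it consists of positive contractions and
`‖a - a u_l‖ → 0` along `Λ` for every `a`. -/
structure IsApproximateUnit {A : Type*} [NonUnitalCStarAlgebra A] [PartialOrder A]
    {Λ : Type*} (r : Λ → Λ → Prop) (u : Λ → A) : Prop where
  nonempty : Nonempty Λ
  trans : ∀ i j k : Λ, r i j → r j k → r i k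
  directed : ∀ i j : Λ, ∃ k : Λ, r i k ∧ r j k
  mem_ball : ∀ i : Λ, u i ∈ PositiveUnitBall A
  approx : ∀ a : A, ∀ ε : ℝ, 0 < ε → ∃ i : Λ, ∀ j : Λ, r i j → ‖a - a * u j‖ < ε

/-- `A` is `σ`-unital: it has a countable approximate unit. (Every countable type is equivalent to
one in `Type`, so fixing the universe of the index set loses nothing.) -/
def IsSigmaUnital (A : Type*) [NonUnitalCStarAlgebra A] [PartialOrder A] : Prop :=
  ∃ (Λ : Type) (r : Λ → Λ → Prop) (u : Λ → A), Countable Λ ∧ IsApproximateUnit r u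

end WayBelowUnits

namespace WayBelowUnits

variable {A : Type*} [NonUnitalCStarAlgebra A]

/-! A countable directed `B` has a cofinal sequence `b 0 ≪ b 1 ≪ …`. It suffices to find positive
contractions `w i` with `b i ≪ w i ≪ w (i + 1)` that approximate every `u l`; then `B ∪ range w` is
the unit. The `w i` are limits of finite chains. A new top near `1 - (1 - c) (1 - e) (1 - c)`, with
`c = b (m + 1)` and `e` far out in the approximate unit, is exactly above `b m` but only
approximately above the old top `v`. Functional calculus (`exists_cut`) restores exactness: for
functions `g ≪ f` of the new element, `g v g ≪ f` while `g v g` stays close to `v`. This correction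
runs down the whole chain (`exists_extend_of_approx`). With summable perturbations the chains
converge, and `≪`, being an equation, survives the limit. -/

lemma WayBelow.trans {a b c : A} (hab : WayBelow a b) (hbc : WayBelow b c) : WayBelow a c := by
  unfold WayBelow at *
  calc a = a * (b * c) := by rw [← hbc, ← hab]
    _ = a * c := by rw [← mul_assoc, ← hab]

lemma IsWayBelowDirected.exists_seq {B : Set A} (hB : IsWayBelowDirected B) (hc : B.Countable)
    (hne : B.Nonempty) :
    ∃ b : ℕ → A, (∀ i, b i ∈ B) ∧ (∀ i, WayBelow (b i) (b (i + 1))) ∧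
      ∀ x ∈ B, ∃ i, WayBelow x (b i) := by
  obtain ⟨β, rfl⟩ := hc.exists_eq_range hne
  have step : ∀ i j, ∃ k, WayBelow (β i) (β k) ∧ WayBelow (β j) (β k) := fun i j => by
    obtain ⟨-, ⟨k, rfl⟩, h⟩ := hB (β i) ⟨i, rfl⟩ (β j) ⟨j, rfl⟩
    exact ⟨k, h⟩
  choose F hF1 hF2 using step
  -- Term `n + 1` dominates both its predecessor and the `n`-th element of `B`.
  let κ : ℕ → ℕ := fun n => Nat.rec 0 (fun n k => F k n) n
  refine ⟨fun n => β (κ n), fun i => ⟨_, rfl⟩, fun i => hF1 _ _, ?_⟩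
  rintro - ⟨n, rfl⟩
  exact ⟨n + 1, hF2 (κ n) n⟩

variable [PartialOrder A]

/-- The first `m` terms of `v` are positive contractions with `v i ≪ v (i + 1)` and `b i ≪ v i`. -/
structure IsChainAbove (b : ℕ → A) (m : ℕ) (v : ℕ → A) : Prop where
  mem_ball : ∀ i < m, v i ∈ PositiveUnitBall A
  above : ∀ i < m, WayBelow (b i) (v i)
  chain : ∀ i, i + 1 < m → WayBelow (v i) (v (i + 1))

lemma IsChainAbove.mono {b v : ℕ → A} {m n : ℕ} (h : IsChainAbove b n v) (hmn : m ≤ n) :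
    IsChainAbove b m v :=
  ⟨fun i hi => h.mem_ball i (by omega), fun i hi => h.above i (by omega),
    fun i hi => h.chain i (by omega)⟩

lemma IsChainAbove.update {b v : ℕ → A} {m : ℕ} (h : IsChainAbove b m v) {w : A}
    (hw : w ∈ PositiveUnitBall A) (hbw : WayBelow (b m) w)
    (hvw : ∀ i, i + 1 = m → WayBelow (v i) w) :
    IsChainAbove b (m + 1) (Function.update v m w) := by
  refine ⟨fun i hi => ?_, fun i hi => ?_, fun i hi => ?_⟩
  · rcases Nat.lt_succ_iff_lt_or_eq.1 hi with h' | rfl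
    · rw [Function.update_of_ne h'.ne]; exact h.mem_ball i h'
    · rwa [Function.update_self]
  · rcases Nat.lt_succ_iff_lt_or_eq.1 hi with h' | rfl
    · rw [Function.update_of_ne h'.ne]; exact h.above i h'
    · rwa [Function.update_self]
  · have hi' : i ≠ m := by omega
    rw [Function.update_of_ne hi']
    rcases Nat.lt_succ_iff_lt_or_eq.1 hi with h' | h'
    · rw [Function.update_of_ne h'.ne]; exact h.chain i h'
    · rw [h', Function.update_self]; exact hvw i h'

lemma IsApproximateUnit.exists_approxWayBelow {Λ : Type*} {r : Λ → Λ → Prop} {u : Λ → A}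
    (hu : IsApproximateUnit r u) (S : Finset A) {ε : ℝ} (hε : 0 < ε) :
    ∃ l, ∀ x ∈ S, ApproxWayBelow ε x (u l) := by
  -- Bounds on a whole tail can be combined by directedness. As `r` need not be reflexive, a final
  -- step beyond `l` picks an index in the tail.
  suffices h : ∃ l, ∀ x ∈ S, ∀ k, r l k → ApproxWayBelow ε x (u k) by
    obtain ⟨l, hl⟩ := h
    obtain ⟨k, hk, -⟩ := hu.directed l l
    exact ⟨k, fun x hx => hl x hx k hk⟩
  classical
  induction S using Finset.induction_on with
  | empty => exact ⟨hu.nonempty.some, by simp⟩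
  | insert a S _ ih =>
    obtain ⟨l, hl⟩ := ih
    obtain ⟨i, hi⟩ := hu.approx a ε hε
    obtain ⟨k, hlk, hik⟩ := hu.directed l i
    refine ⟨k, fun x hx j hj => ?_⟩
    rcases Finset.mem_insert.1 hx with rfl | hx
    · exact hi j (hu.trans _ _ _ hik hj)
    · exact hl x hx j (hu.trans _ _ _ hlk hj)

/-! ### Functional calculus on positive contractions -/

variable [StarOrderedRing A]

lemma quasispectrum_subset_Icc {w : A} (hw : w ∈ PositiveUnitBall A) {t : ℝ}
    (ht : t ∈ quasispectrum ℝ w) : t ∈ Set.Icc (0 : ℝ) 1 := by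
  refine ⟨quasispectrum_nonneg_of_nonneg w hw.1 t ht, ?_⟩
  have h0 : 0 ≤ w := hw.1
  have h := norm_apply_le_norm_cfcₙ (𝕜 := ℝ) (id : ℝ → ℝ) w ht
  rw [cfcₙ_id ℝ w] at h
  exact (le_abs_self t).trans (h.trans hw.2)

lemma cfcₙ_mem_positiveUnitBall {w : A} (hw : w ∈ PositiveUnitBall A) {f : ℝ → ℝ}
    (hf : ∀ t ∈ Set.Icc (0 : ℝ) 1, f t ∈ Set.Icc (0 : ℝ) 1) :
    cfcₙ f w ∈ PositiveUnitBall A := by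
  refine ⟨cfcₙ_nonneg fun t ht => (hf t (quasispectrum_subset_Icc hw ht)).1, ?_⟩
  refine norm_cfcₙ_le fun t ht => ?_
  have := hf t (quasispectrum_subset_Icc hw ht)
  rw [Real.norm_of_nonneg this.1]
  exact this.2

/-- If `1 - f t = (1 - t) (1 - m t)`, then `f w` acts as a right unit about as well as `w`. -/
lemma norm_sub_mul_cfcₙ_le {w : A} (hw : w ∈ PositiveUnitBall A) {m : ℝ → ℝ} {C : ℝ}
    (hm : Continuous m) (hm0 : m 0 = 0) (hmC : ∀ t ∈ Set.Icc (0 : ℝ) 1, |m t| ≤ C)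
    (a : A) :
    ‖a - a * cfcₙ (fun t => m t + (t - t * m t)) w‖ ≤ (1 + C) * ‖a - a * w‖ := by
  have h0 : 0 ≤ w := hw.1
  have hsa : IsSelfAdjoint w := h0.isSelfAdjoint
  have hfw : cfcₙ (fun t => m t + (t - t * m t)) w = cfcₙ m w + (w - w * cfcₙ m w) := by
    rw [cfcₙ_add (a := w) m (fun t => t - t * m t) (by fun_prop) hm0 (by fun_prop) (by simp),
      cfcₙ_sub (a := w) (fun t => t) (fun t => t * m t) (by fun_prop) rfl (by fun_prop) (by simp),
      cfcₙ_mul (a := w) (fun t => t) m (by fun_prop) rfl (by fun_prop) hm0, cfcₙ_id' ℝ w]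
  have hmw : ‖cfcₙ m w‖ ≤ C := norm_cfcₙ_le fun t ht => hmC t (quasispectrum_subset_Icc hw ht)
  have e : a - a * (cfcₙ m w + (w - w * cfcₙ m w)) = (a - a * w) - (a - a * w) * cfcₙ m w := by
    noncomm_ring
  rw [hfw, e]
  calc _ ≤ ‖a - a * w‖ + ‖(a - a * w) * cfcₙ m w‖ := norm_sub_le _ _
    _ ≤ ‖a - a * w‖ + ‖a - a * w‖ * C := by
        gcongr
        exact (norm_mul_le _ _).trans (by gcongr)
    _ = _ := by ring

/-- On `[0, 1]`, `f t = min 1 (t / (1 - δ))` and `g` vanishes up to `1 - δ`, then rises linearly to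
`1`; so `f = 1` wherever `g ≠ 0`. Moreover `1 - t` divides `1 - g t`, so `g` inherits approximation
from `w`, and `t` divides `f t`, so `f` inherits right units. -/
lemma exists_cut {w : A} (hw : w ∈ PositiveUnitBall A) {δ : ℝ} (hδ : 0 < δ) (hδ1 : δ < 1) :
    ∃ f ∈ PositiveUnitBall A, ∃ g ∈ PositiveUnitBall A, ‖f - w‖ ≤ δ ∧ WayBelow g f ∧
      (∀ a : A, ‖a - a * g‖ ≤ (2 + 1 / δ) * ‖a - a * w‖) ∧
      ∀ z : A, WayBelow w z → WayBelow f z := by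
  have h0 : 0 ≤ w := hw.1
  have hsa : IsSelfAdjoint w := h0.isSelfAdjoint
  have hp : ∀ t : ℝ, 0 < max (1 - δ) t := fun t => lt_max_of_lt_left (by linarith)
  have hq : ∀ t : ℝ, 0 < max (1 - t) δ := fun t => lt_max_of_lt_right hδ
  let l : ℝ → ℝ := fun t => (max (1 - δ) t)⁻¹
  let m : ℝ → ℝ := fun t => 1 - (max (1 - t) δ)⁻¹
  have hl : Continuous l := Continuous.inv₀ (by fun_prop) fun t => (hp t).ne'
  have hm : Continuous m :=
    continuous_const.sub (Continuous.inv₀ (by fun_prop) fun t => (hq t).ne')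
  have hm0 : m 0 = 0 := by simp [m, max_eq_left hδ1.le]
  have hg : ∀ t, m t + (t - t * m t) = 1 - (1 - t) / max (1 - t) δ := fun t => by
    simp only [m]; field_simp; ring
  refine ⟨cfcₙ (fun t => t * l t) w, ?_, cfcₙ (fun t => m t + (t - t * m t)) w, ?_, ?_, ?_, ?_, ?_⟩
  · refine cfcₙ_mem_positiveUnitBall hw fun t ht => ?_
    have := hp t
    refine ⟨mul_nonneg ht.1 (inv_nonneg.2 this.le), ?_⟩
    change t * (max (1 - δ) t)⁻¹ ≤ 1
    rw [← div_eq_mul_inv, div_le_one this]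
    exact le_max_right _ _
  · refine cfcₙ_mem_positiveUnitBall hw fun t ht => ?_
    have := hq t
    rw [hg]
    refine ⟨?_, ?_⟩
    · rw [sub_nonneg, div_le_one this]
      exact le_max_left _ _
    · have : 0 ≤ (1 - t) / max (1 - t) δ := div_nonneg (by linarith [ht.2]) this.le
      linarith
  · nth_rw 2 [← cfcₙ_id' ℝ w]
    rw [← cfcₙ_sub (a := w) (fun t => t * l t) (fun t => t) (by fun_prop) (by simp)
      (by fun_prop) rfl]
    refine norm_cfcₙ_le fun t ht => ?_
    have ht := quasispectrum_subset_Icc hw ht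
    rw [Real.norm_eq_abs, abs_le]
    rcases le_total (1 - δ) t with h | h
    · have e : t * l t = 1 := by
        simp only [l, max_eq_right h]
        exact mul_inv_cancel₀ (by linarith)
      rw [e]
      constructor <;> linarith [ht.2]
    · have e : t * l t - t = t / (1 - δ) * δ := by
        have : (1 - δ) ≠ 0 := by linarith
        simp only [l, max_eq_left h]
        field_simp
        ring
      have h1 : t / (1 - δ) ≤ 1 := (div_le_one (by linarith)).2 h
      have h2 : 0 ≤ t / (1 - δ) := div_nonneg ht.1 (by linarith)
      rw [e]
      constructor <;> nlinarith
  · unfold WayBelow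
    rw [← cfcₙ_mul (a := w) (fun t => m t + (t - t * m t)) (fun t => t * l t) (by fun_prop)
      (by simp [hm0]) (by fun_prop) (by simp)]
    refine cfcₙ_congr fun t ht => ?_
    have ht := quasispectrum_subset_Icc hw ht
    simp only [hg]
    rcases le_total (1 - δ) t with h | h
    · have e : t * l t = 1 := by
        simp only [l, max_eq_right h]
        exact mul_inv_cancel₀ (by linarith)
      rw [e, mul_one]
    · have h' : δ ≤ 1 - t := by linarith
      rw [max_eq_left h', div_self (by linarith)]
      simp
  · intro a
    refine (norm_sub_mul_cfcₙ_le hw hm hm0 (C := 1 + 1 / δ) (fun t _ => ?_)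
      a).trans (le_of_eq (by ring))
    have h1 : (max (1 - t) δ)⁻¹ ≤ 1 / δ := by
      rw [one_div]
      exact inv_anti₀ hδ (le_max_right _ _)
    have h2 : 0 < (max (1 - t) δ)⁻¹ := inv_pos.2 (hq t)
    have h3 : 0 < 1 / δ := by positivity
    simp only [m, abs_le]
    constructor <;> linarith
  · intro z hz
    unfold WayBelow at *
    -- Only functions vanishing at `0` are available without a unit, so the constant `l 0` is split
    -- off.
    let n : ℝ → ℝ := fun t => l t - l 0
    have hn : Continuous n := hl.sub continuous_const
    have e : cfcₙ (fun t => t * l t) w = l 0 • w + cfcₙ n w * w := by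
      have : (fun t => t * l t) = fun t => l 0 * t + n t * t := by
        ext t; simp only [n]; ring
      rw [this, cfcₙ_add (a := w) (fun t => l 0 * t) (fun t => n t * t) (by fun_prop) (by simp)
        (by fun_prop) (by simp), cfcₙ_const_mul_id (l 0) w,
        cfcₙ_mul (a := w) n (fun t => t) (by fun_prop) (by simp [n]) (by fun_prop) rfl,
        cfcₙ_id' ℝ w]
    rw [e, add_mul, smul_mul_assoc, mul_assoc, ← hz]

open scoped CStarAlgebra in
/-- The element `1 - (1 - c) (1 - e) (1 - c)` of `A`. -/
lemma exists_wayBelow_of_approx {c e : A} (hc : c ∈ PositiveUnitBall A)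
    (he : e ∈ PositiveUnitBall A) :
    ∃ w ∈ PositiveUnitBall A, (∀ b : A, WayBelow b c → WayBelow b w) ∧
      ∀ a : A, ‖a - a * w‖ ≤ 2 * ‖(a - a * c) - (a - a * c) * e‖ := by
  refine ⟨c + c - c * c + e - c * e - e * c + c * e * c, ?_, ?_, ?_⟩
  · set w := c + c - c * c + e - c * e - e * c + c * e * c with hw
    have key : (w : Unitization ℂ A) = 1 - (1 - c) * (1 - e) * (1 - c) := by
      simp only [hw, Unitization.inr_add, Unitization.inr_sub, Unitization.inr_mul]
      noncomm_ring
    have hc1 : IsSelfAdjoint (1 - (c : Unitization ℂ A)) :=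
      (IsSelfAdjoint.one _).sub (hc.1.isSelfAdjoint.inr ℂ)
    have hE := CStarAlgebra.inr_mem_Icc_iff_norm_le.2 he
    have hC := CStarAlgebra.inr_mem_Icc_iff_norm_le.2 hc
    refine CStarAlgebra.inr_mem_Icc_iff_norm_le.1 ⟨?_, ?_⟩
    · rw [key]
      -- The element equals `(1 - c) e (1 - c) + c (1 - c) c + (1 - c) c (1 - c) + c`, a sum of
      -- positive terms.
      have h1 := hc1.conjugate_nonneg hE.1
      have h2 : (0 : Unitization ℂ A) ≤ c * (1 - c) * c :=
        (hc.1.isSelfAdjoint.inr ℂ).conjugate_nonneg (sub_nonneg.2 hC.2)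
      have h3 := hc1.conjugate_nonneg hC.1
      have := add_nonneg (add_nonneg h1 (add_nonneg h2 h3)) hC.1
      convert this using 1
      noncomm_ring
    · rw [key]
      exact sub_le_self _ (hc1.conjugate_nonneg (sub_nonneg.2 hE.2))
  · intro b hb
    unfold WayBelow at *
    simp only [mul_add, mul_sub, ← mul_assoc, ← hb]
    abel
  · intro a
    have e1 : a - a * (c + c - c * c + e - c * e - e * c + c * e * c) =
        ((a - a * c) - (a - a * c) * e) - ((a - a * c) - (a - a * c) * e) * c := by
      noncomm_ring
    rw [e1]
    set x := (a - a * c) - (a - a * c) * e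
    calc _ ≤ ‖x‖ + ‖x * c‖ := norm_sub_le _ _
      _ ≤ ‖x‖ + ‖x‖ * 1 := by
          gcongr
          exact (norm_mul_le _ _).trans (by gcongr; exact hc.2)
      _ = _ := by ring

lemma mul_mul_mem_positiveUnitBall {v g : A} (hv : v ∈ PositiveUnitBall A)
    (hg : g ∈ PositiveUnitBall A) : g * v * g ∈ PositiveUnitBall A := by
  refine ⟨hg.1.isSelfAdjoint.conjugate_nonneg hv.1, ?_⟩
  calc _ ≤ ‖g‖ * ‖v‖ * ‖g‖ := (norm_mul_le _ _).trans (by gcongr; exact norm_mul_le _ _)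
    _ ≤ 1 * 1 * 1 := by gcongr <;> first | exact hg.2 | exact hv.2
    _ = 1 := by norm_num

lemma norm_sub_mul_mul_le {v g : A} (hv : v ∈ PositiveUnitBall A)
    (hg : g ∈ PositiveUnitBall A) : ‖g * v * g - v‖ ≤ 2 * ‖v - v * g‖ := by
  have h1 : ‖v - g * v‖ = ‖v - v * g‖ := by
    rw [← norm_star, star_sub, star_mul, hv.1.isSelfAdjoint.star_eq, hg.1.isSelfAdjoint.star_eq]
  have e : g * v * g - v = -((v - v * g) + (v - g * v) * g) := by noncomm_ring
  rw [e, norm_neg]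
  calc _ ≤ ‖v - v * g‖ + ‖v - g * v‖ * ‖g‖ :=
        (norm_add_le _ _).trans (by gcongr; exact norm_mul_le _ _)
    _ ≤ ‖v - v * g‖ + ‖v - v * g‖ * 1 := by rw [h1]; gcongr; exact hg.2
    _ = _ := by ring

lemma isClosed_positiveUnitBall : IsClosed (PositiveUnitBall A) :=
  (CStarAlgebra.isClosed_nonneg (A := A)).inter (isClosed_le continuous_norm continuous_const)

/-! ### Extending finite chains by small perturbations -/

/-- A chain whose last term is almost `≪ w` is close to a chain that continues to an element
close to `w`. -/
lemma IsChainAbove.exists_extend_of_approx {b : ℕ → A} (hb : ∀ i, WayBelow (b i) (b (i + 1)))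
    (m : ℕ) {v : ℕ → A} (hv : IsChainAbove b m v) {ε : ℝ} (hε : 0 < ε) :
    ∃ η > 0, ∀ w ∈ PositiveUnitBall A, WayBelow (b m) w →
      (∀ i, i + 1 = m → ApproxWayBelow η (v i) w) →
      ∃ v' : ℕ → A, IsChainAbove b (m + 1) v' ∧ (∀ i < m, ‖v' i - v i‖ < ε) ∧
        ‖v' m - w‖ < ε ∧ ∀ z : A, WayBelow w z → WayBelow (v' m) z := by
  induction m generalizing ε with
  | zero =>
    refine ⟨1, one_pos, fun w hw hbw _ => ⟨Function.update v 0 w, ?_, by simp, by simpa, by simp⟩⟩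
    exact hv.update hw hbw (by simp)
  | succ m ih =>
    obtain ⟨η₀, hη₀, H⟩ := ih (hv.mono m.le_succ) (half_pos hε)
    obtain ⟨δ, hδ, hδlt⟩ : ∃ δ : ℝ, 0 < δ ∧ δ < min 1 ε :=
      exists_between (lt_min one_pos hε)
    have hK : 0 < 2 * (2 + 1 / δ) := by positivity
    set κ := min η₀ (ε / 2) with hκ
    have hκ0 : 0 < κ := lt_min hη₀ (half_pos hε)
    -- Passing from `w` to `g` costs a factor `2 + 1 / δ`, and compressing `v m` on both sides by
    -- `g` another `2`.
    refine ⟨κ / (2 * (2 + 1 / δ)), div_pos hκ0 hK, fun w hw hbw hvw => ?_⟩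
    obtain ⟨f, hf, g, hg, hfw, hgf, hag, hfz⟩ :=
      exists_cut hw hδ (hδlt.trans_le (min_le_left _ _))
    have hvm := hv.mem_ball m m.lt_succ_self
    have hexact : ∀ {a : A}, WayBelow a w → WayBelow a g := fun {a} ha => by
      have h := hag a
      unfold WayBelow at ha ⊢
      rw [← ha, sub_self, norm_zero, mul_zero] at h
      exact sub_eq_zero.1 (norm_le_zero_iff.1 h)
    have hbg : WayBelow (b (m + 1)) g := hexact hbw
    have hbmg : WayBelow (b m) g := (hb m).trans hbg
    set y := g * v m * g with hy
    have hyball : y ∈ PositiveUnitBall A := mul_mul_mem_positiveUnitBall hvm hg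
    have hyv : ‖y - v m‖ < κ := by
      have h1 : ‖v m - v m * w‖ < κ / (2 * (2 + 1 / δ)) := hvw m rfl
      calc _ ≤ 2 * ‖v m - v m * g‖ := norm_sub_mul_mul_le hvm hg
        _ ≤ 2 * ((2 + 1 / δ) * ‖v m - v m * w‖) := by gcongr; exact hag _
        _ = (2 * (2 + 1 / δ)) * ‖v m - v m * w‖ := by ring
        _ < κ := by rwa [lt_div_iff₀' hK] at h1
    have hby : WayBelow (b m) y := by
      have hbv := hv.above m m.lt_succ_self
      unfold WayBelow at *
      rw [hy, ← mul_assoc, ← mul_assoc, ← hbmg, ← hbv, ← hbmg]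
    have hyf : WayBelow y f := by
      unfold WayBelow at *
      rw [hy, mul_assoc (g * v m), ← hgf]
    -- The shorter chain is extended to end near `y`, since its top was exactly below `v m`. The new
    -- end need not be `y`, but `hz` keeps it below `f`.
    obtain ⟨v', hv', hclose, hlast, hz⟩ := H y hyball hby fun i hi => by
      have hc := hv.chain i (by omega)
      have hi1 := (hv.mem_ball i (by omega)).2
      unfold WayBelow at hc
      unfold ApproxWayBelow
      have e : v i - v i * y = v i * (v m - y) := by
        rw [mul_sub, ← hi, ← hc]
      rw [e]
      calc _ ≤ ‖v i‖ * ‖v m - y‖ := norm_mul_le _ _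
        _ ≤ 1 * ‖y - v m‖ := by rw [norm_sub_rev]; gcongr
        _ < η₀ := by rw [one_mul]; exact hyv.trans_le (min_le_left _ _)
    refine ⟨Function.update v' (m + 1) f, hv'.update hf (hbg.trans hgf) ?_, ?_, ?_, ?_⟩
    · intro i hi
      obtain rfl : i = m := by omega
      exact hz f hyf
    · intro i hi
      rw [Function.update_of_ne hi.ne]
      rcases Nat.lt_succ_iff_lt_or_eq.1 hi with h | rfl
      · exact (hclose i h).trans (half_lt_self hε)
      · calc _ ≤ ‖v' i - y‖ + ‖y - v i‖ := norm_sub_le_norm_sub_add_norm_sub _ _ _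
          _ < ε / 2 + ε / 2 := add_lt_add hlast (hyv.trans_le (min_le_right _ _))
          _ = ε := add_halves ε
    · rw [Function.update_self]
      exact hfw.trans_lt (hδlt.trans_le (min_le_right _ _))
    · intro z hzw
      rw [Function.update_self]
      exact hfz z hzw

lemma IsChainAbove.exists_extend {Λ : Type*} {r : Λ → Λ → Prop} {u : Λ → A}
    (hu : IsApproximateUnit r u) {b : ℕ → A} (hbball : ∀ i, b i ∈ PositiveUnitBall A)
    (hb : ∀ i, WayBelow (b i) (b (i + 1))) {m : ℕ} {v : ℕ → A} (hv : IsChainAbove b m v)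
    (S : Finset A) (hS : ∀ x ∈ S, ‖x‖ ≤ 1) {ε : ℝ} (hε : 0 < ε) :
    ∃ v' : ℕ → A, IsChainAbove b (m + 1) v' ∧ (∀ i < m, ‖v' i - v i‖ < ε) ∧
      ∀ x ∈ S, ApproxWayBelow ε x (v' m) := by
  classical
  obtain ⟨η, hη, H⟩ := hv.exists_extend_of_approx hb m (half_pos hε)
  set κ := min (η / 2) (ε / 4)
  have hκ : 0 < κ := lt_min (half_pos hη) (by linarith)
  let c := b (m + 1)
  -- For `m = 0` the entry `v (m - 1)` is a harmless default.
  let T : Finset A := insert (v (m - 1)) S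
  obtain ⟨l, hl⟩ := hu.exists_approxWayBelow (T.image fun x => x - x * c) hκ
  obtain ⟨w, hw, hcw, haw⟩ := exists_wayBelow_of_approx (hbball (m + 1)) (hu.mem_ball l)
  have hT : ∀ x ∈ T, ‖x - x * w‖ < 2 * κ := fun x hx => by
    have : ‖x - x * c - (x - x * c) * u l‖ < κ := hl _ (Finset.mem_image_of_mem _ hx)
    exact (haw x).trans_lt (by gcongr)
  obtain ⟨v', hv', hclose, hlast, -⟩ := H w hw (hcw _ (hb m)) fun i hi => by
    have := hT (v (m - 1)) (Finset.mem_insert_self _ _)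
    obtain rfl : i = m - 1 := by omega
    refine this.trans_le ?_
    linarith [min_le_left (η / 2) (ε / 4)]
  refine ⟨v', hv', fun i hi => (hclose i hi).trans (half_lt_self hε), fun x hx => ?_⟩
  have h1 := hT x (Finset.mem_insert_of_mem hx)
  unfold ApproxWayBelow
  have e : x - x * v' m = (x - x * w) - x * (v' m - w) := by noncomm_ring
  rw [e]
  calc _ ≤ ‖x - x * w‖ + ‖x‖ * ‖v' m - w‖ :=
        (norm_sub_le _ _).trans (by gcongr; exact norm_mul_le _ _)
    _ ≤ ‖x - x * w‖ + 1 * ‖v' m - w‖ := by gcongr; exact hS x hx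
    _ < ε := by linarith [min_le_right (η / 2) (ε / 4)]

/-! ### Passing to the limit -/

open Filter Topology in
lemma exists_chain_above {Λ : Type*} [Countable Λ] {r : Λ → Λ → Prop} {u : Λ → A}
    (hu : IsApproximateUnit r u) {b : ℕ → A} (hbball : ∀ i, b i ∈ PositiveUnitBall A)
    (hb : ∀ i, WayBelow (b i) (b (i + 1))) :
    ∃ w : ℕ → A, (∀ i, w i ∈ PositiveUnitBall A) ∧ (∀ i, WayBelow (b i) (w i)) ∧
      (∀ i, WayBelow (w i) (w (i + 1))) ∧
      ∀ l, ∀ ε > 0, ∃ i, ApproxWayBelow ε (u l) (w i) := by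
  classical
  have := hu.nonempty
  obtain ⟨e, he⟩ := exists_surjective_nat Λ
  let p : ℕ → ℝ := fun m => (1 / 2) ^ m
  have hp : ∀ m, 0 < p m := fun m => by positivity
  have step : ∀ m (v : ℕ → A), IsChainAbove b m v → ∃ v' : ℕ → A, IsChainAbove b (m + 1) v' ∧
      (∀ i < m, ‖v' i - v i‖ < p m) ∧ ∀ j < m, ApproxWayBelow (p m) (u (e j)) (v' m) := by
    intro m v hv
    obtain ⟨v', h1, h2, h3⟩ := hv.exists_extend hu hbball hb
      ((Finset.range m).image fun j => u (e j)) (by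
        intro x hx
        obtain ⟨j, -, rfl⟩ := Finset.mem_image.1 hx
        exact (hu.mem_ball _).2) (hp m)
    exact ⟨v', h1, h2, fun j hj => h3 _ (Finset.mem_image_of_mem _ (Finset.mem_range.2 hj))⟩
  choose F hF1 hF2 hF3 using step
  let V : ∀ m, {v : ℕ → A // IsChainAbove b m v} := fun m =>
    Nat.rec ⟨fun _ => 0, ⟨by simp, by simp, by simp⟩⟩ (fun m v => ⟨F m v.1 v.2, hF1 m v.1 v.2⟩) m
  have hV1 : ∀ m, ∀ i < m, ‖(V (m + 1)).1 i - (V m).1 i‖ < p m := fun m =>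
    hF2 m (V m).1 (V m).2
  have hV2 : ∀ m, ∀ j < m, ApproxWayBelow (p m) (u (e j)) ((V (m + 1)).1 m) := fun m =>
    hF3 m (V m).1 (V m).2
  -- Position `i` is first filled at stage `i + 1`; the later changes sum to at most `p i`.
  let s : ℕ → ℕ → A := fun i k => (V (i + 1 + k)).1 i
  have hs : ∀ i k, dist (s i k) (s i (k + 1)) ≤ p (i + 1) * (1 / 2) ^ k := fun i k => by
    rw [dist_comm, dist_eq_norm, ← pow_add]
    exact (hV1 (i + 1 + k) i (by omega)).le
  have hlim : ∀ i, ∃ w, Tendsto (s i) atTop (𝓝 w) := fun i =>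
    cauchySeq_tendsto_of_complete (cauchySeq_of_le_geometric _ _ (by norm_num) (hs i))
  choose w hw using hlim
  have hdist : ∀ i, ‖(V (i + 1)).1 i - w i‖ ≤ p i := fun i => by
    have := dist_le_of_le_geometric_of_tendsto₀ _ _ (by norm_num) (hs i) (hw i)
    rw [dist_eq_norm] at this
    refine this.trans (le_of_eq ?_)
    simp only [p, pow_succ]
    ring
  refine ⟨w, fun i => ?_, fun i => ?_, fun i => ?_, fun l ε hε => ?_⟩
  · exact isClosed_positiveUnitBall.mem_of_tendsto (hw i)
      (Eventually.of_forall fun k => (V (i + 1 + k)).2.mem_ball i (by omega))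
  · refine tendsto_nhds_unique (f := fun _ : ℕ => b i) (l := atTop) tendsto_const_nhds ?_
    refine (tendsto_const_nhds.mul (hw i)).congr fun k => ?_
    exact ((V (i + 1 + k)).2.above i (by omega)).symm
  · refine tendsto_nhds_unique ((hw i).comp (tendsto_add_atTop_nat 1)) ?_
    refine (((hw i).comp (tendsto_add_atTop_nat 1)).mul (hw (i + 1))).congr fun k => ?_
    have h := (V (i + 1 + (k + 1))).2.chain i (by omega)
    have h2 : s (i + 1) k = (V (i + 1 + (k + 1))).1 (i + 1) := by
      simp only [s]
      rw [show i + 1 + 1 + k = i + 1 + (k + 1) by omega]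
    rw [h2]
    exact h.symm
  · obtain ⟨j, rfl⟩ := he l
    obtain ⟨n, hn⟩ := exists_pow_lt_of_lt_one (half_pos hε) (by norm_num : (1 / 2 : ℝ) < 1)
    -- Large enough that `u (e j)` was handled at stage `m` and that the stage error and the limit
    -- error are each below `ε / 2`.
    set m := max n (j + 1)
    have hm : p m < ε / 2 := lt_of_le_of_lt
      (pow_le_pow_of_le_one (by norm_num) (by norm_num) (le_max_left _ _)) hn
    refine ⟨m, ?_⟩
    have h1 : ‖u (e j) - u (e j) * (V (m + 1)).1 m‖ < p m :=
      hV2 m j (lt_of_lt_of_le j.lt_succ_self (le_max_right _ _))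
    have h2 := hdist m
    have e1 : u (e j) - u (e j) * w m = (u (e j) - u (e j) * (V (m + 1)).1 m) +
        u (e j) * ((V (m + 1)).1 m - w m) := by noncomm_ring
    unfold ApproxWayBelow
    rw [e1]
    calc _ ≤ ‖u (e j) - u (e j) * (V (m + 1)).1 m‖ + ‖u (e j)‖ * ‖(V (m + 1)).1 m - w m‖ :=
          (norm_add_le _ _).trans (by gcongr; exact norm_mul_le _ _)
      _ ≤ ‖u (e j) - u (e j) * (V (m + 1)).1 m‖ + 1 * ‖(V (m + 1)).1 m - w m‖ := by
          gcongr; exact (hu.mem_ball _).2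
      _ < ε := by linarith

lemma exists_wayBelowUnit_of_nonempty (hA : IsSigmaUnital A) {B : Set A}
    (hBball : B ⊆ PositiveUnitBall A) (hBcount : B.Countable) (hBdir : IsWayBelowDirected B)
    (hne : B.Nonempty) : ∃ U : Set A, U.Countable ∧ IsWayBelowUnit U ∧ B ⊆ U := by
  obtain ⟨Λ, r, u, hΛ, hu⟩ := hA
  obtain ⟨b, hbB, hb, hcof⟩ := hBdir.exists_seq hBcount hne
  obtain ⟨w, hwball, hbw, hww, happ⟩ := exists_chain_above hu (fun i => hBball (hbB i)) hb
  have hlt : ∀ i k, WayBelow (w i) (w (i + 1 + k)) := fun i k => by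
    induction k with
    | zero => exact hww i
    | succ k ih => exact ih.trans (hww _)
  have hev : ∀ x ∈ B ∪ Set.range w, ∃ i, WayBelow x (w i) := by
    rintro x (hx | ⟨i, rfl⟩)
    · obtain ⟨i, hi⟩ := hcof x hx
      exact ⟨i, hi.trans (hbw i)⟩
    · exact ⟨i + 1, hww i⟩
  refine ⟨B ∪ Set.range w, hBcount.union (Set.countable_range w), ⟨?_, ?_, ?_⟩,
    Set.subset_union_left⟩
  · exact Set.union_subset hBball (Set.range_subset_iff.2 hwball)
  · intro a _ ε hε
    obtain ⟨l, hl⟩ := hu.exists_approxWayBelow {a} (show 0 < ε / 4 by linarith)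
    have hl : ‖a - a * u l‖ < ε / 4 := hl a (Finset.mem_singleton_self a)
    have hpos : 0 < ε / (2 * (‖a‖ + 1)) := by positivity
    obtain ⟨i, hi⟩ := happ l _ hpos
    unfold ApproxWayBelow at hi
    rw [lt_div_iff₀ (by positivity)] at hi
    refine ⟨w i, Or.inr ⟨i, rfl⟩, ?_⟩
    unfold ApproxWayBelow
    have e : a - a * w i = (a - a * u l) - (a - a * u l) * w i + a * (u l - u l * w i) := by
      noncomm_ring
    rw [e]
    have h1 : ‖(a - a * u l) * w i‖ ≤ ‖a - a * u l‖ * 1 :=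
      (norm_mul_le _ _).trans (by gcongr; exact (hwball i).2)
    have h2 := norm_mul_le a (u l - u l * w i)
    have h3 := norm_nonneg (u l - u l * w i)
    have h4 := norm_add_le ((a - a * u l) - (a - a * u l) * w i) (a * (u l - u l * w i))
    have h5 := norm_sub_le (a - a * u l) ((a - a * u l) * w i)
    nlinarith
  · intro x hx y hy
    obtain ⟨i, hi⟩ := hev x hx
    obtain ⟨j, hj⟩ := hev y hy
    refine ⟨w (i + 1 + j), Or.inr ⟨_, rfl⟩, hi.trans (hlt i j), hj.trans ?_⟩
    rw [show i + 1 + j = j + 1 + i by omega]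
    exact hlt j i

end WayBelowUnits

theorem corollary4p3 {A : Type*} [NonUnitalCStarAlgebra A] [PartialOrder A] [StarOrderedRing A]
    (hA : WayBelowUnits.IsSigmaUnital A)
    (B : Set A) (hBball : B ⊆ WayBelowUnits.PositiveUnitBall A)
    (hBcount : B.Countable) (hBdir : WayBelowUnits.IsWayBelowDirected B) :
    ∃ U : Set A, U.Countable ∧ WayBelowUnits.IsWayBelowUnit U ∧ B ⊆ U := by
  rcases B.eq_empty_or_nonempty with rfl | hne
  -- The sequence `b` needs a nonempty set; `{0}` is directed because `0 ≪ 0`.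
  · obtain ⟨U, hU, hU', -⟩ := WayBelowUnits.exists_wayBelowUnit_of_nonempty hA (B := {0})
      (by simp [WayBelowUnits.PositiveUnitBall]) (Set.countable_singleton 0)
      (by simp [WayBelowUnits.IsWayBelowDirected, DirectedOn, WayBelowUnits.WayBelow])
      (Set.singleton_nonempty 0)
    exact ⟨U, hU, hU', Set.empty_subset U⟩
  · exact WayBelowUnits.exists_wayBelowUnit_of_nonempty hA hBball hBcount hBdir hne
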